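/- Let $d\ge 2$ and $\mathcal H=\mathbb C^d$ with orthonormal basis $|0\rangle,\dots,|d-1\rangle$. Let $\mathbb S=\sum_{ij}|ij\rangle\langle ji|$ be the swap operator on $\mathcal H_A\otimes\mathcal H_B$, with $\mathcal H_A=\mathcal H_B=\mathcal H$, and let $K_0=d\,\mathbb 1-\mathbb S$. Write $X\star Y=\frac12(XY+YX)$, and let $T_A$ denote the partial transpose on the first factor. For states $\rho,\sigma$ on $\mathcal H$ the unitarily invariant optimal transport cost is $$\mathcal K(\rho,\sigma)=\min_J\ \operatorname{Tr}\big[K_0\,((\rho\otimes\mathbb 1)\star J)\big],$$ where the minimum is over all operators $J$ on $\mathcal H_A\otimes\mathcal H_B$ with $J^{T_A}\ge 0$, $\operatorname{Tr}_B J=\mathbb 1$ and $\operatorname{Tr}_A[(\rho\otimes\mathbb 1)J]=\sigma$. These $J$ are exactly the Jamiołkowski matrices $J_{\mathcal E}=(\mathrm{id}\otimes\mathcal E)(\mathbb S)$ of the quantum channels (completely positive trace-preserving maps) $\mathcal E$ with $\mathcal E(\rho)=\sigma$; a channel is called optimal if its Jamiołkowski matrix attains the minimum. (a) Let $0\le\alpha\le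 1$, $|\varphi_\alpha\rangle=\alpha|0\rangle+\sqrt{1-\alpha^2}\,|1\rangle$, $\rho=|0\rangle\langle 0|$ and $\sigma=|\varphi_\alpha\rangle\langle\varphi_\alpha|$. Then $$\mathcal K(\rho,\sigma)=(1-\alpha)(d+2\alpha),$$ and the channel $X\mapsto U_\alpha XU_\alpha^*$ is optimal, where $$U_\alpha=\begin{bmatrix}\alpha&-\sqrt{1-\alpha^2}\\ \sqrt{1-\alpha^2}&\alpha\end{bmatrix}\oplus\mathbb 1_{d-2}.$$ If $\alpha>0$, it is the only optimal channel. (b) For arbitrary unit vectors $\psi,\varphi\in\mathcal H$ and $\alpha=|\langle\psi|\varphi\rangle|$ one has $\mathcal K(|\psi\rangle\langle\psi|,|\varphi\rangle\langle\varphi|)=(1-\alpha)(d+2\alpha)$. Moreover, there is a unitary $V$ with $V|\psi\rangle\langle\psi|V^*=|0\rangle\langle 0|$ and $V|\varphi\rangle\langle\varphi|V^*=|\varphi_\alpha\rangle\langle\varphi_\alpha|$ such that conjugation with $V^*U_\alpha V$ is an optimal channel. -/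

import Mathlib

open Matrix
open scoped ComplexOrder

noncomputable section

/-- Partial transpose on the first tensor factor:
`⟨ik| X^{T_A} |jl⟩ = ⟨jk| X |il⟩`. -/
def partialTransposeA {A B : Type*} (X : Matrix (A × B) (A × B) ℂ) :
    Matrix (A × B) (A × B) ℂ :=
  Matrix.of fun p q => X (q.1, p.2) (p.1, q.2)

/-- Partial trace over the second tensor factor. -/
def partialTraceB {A B : Type*} [Fintype B] (X : Matrix (A × B) (A × B) ℂ) :
    Matrix A A ℂ :=
  Matrix.of fun i j => ∑ k, X (i, k) (j, k)

/-- Partial trace over the first tensor factor. -/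
def partialTraceA {A B : Type*} [Fintype A] (X : Matrix (A × B) (A × B) ℂ) :
    Matrix B B ℂ :=
  Matrix.of fun k l => ∑ i, X (i, k) (i, l)

/-- The swap operator `S = ∑ i j, |ij⟩⟨ji|`. -/
def swapOperator (A : Type*) [DecidableEq A] : Matrix (A × A) (A × A) ℂ :=
  Matrix.of fun p q => if p.1 = q.2 ∧ p.2 = q.1 then 1 else 0

/-- The Jordan product `X ⋆ Y = (XY + YX) / 2`. -/
def jordanProduct {I : Type*} [Fintype I] (X Y : Matrix I I ℂ) : Matrix I I ℂ :=
  (1 / 2 : ℂ) • (X * Y + Y * X)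

/-- The extension `ρ ⊗ 1` of an operator on the first factor. -/
def extendA {A : Type*} (B : Type*) [DecidableEq B] (ρ : Matrix A A ℂ) :
    Matrix (A × B) (A × B) ℂ :=
  Matrix.kroneckerMap (· * ·) ρ (1 : Matrix B B ℂ)

/-- The set of Jamiołkowski matrices of quantum channels from system `A` to system `B`:
`J^{T_A} ≥ 0` and `Tr_B J = 1`. -/
def jamiolkowskiMatrices (A B : Type*) [Fintype B] [DecidableEq A] :
    Set (Matrix (A × B) (A × B) ℂ) :=
  {J | (partialTransposeA J).PosSemidef ∧ partialTraceB J = 1}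

/-- The state over time `ρ ⋆ J`, where `ρ` stands for `ρ ⊗ 1`. -/
def stateOverTime {A B : Type*} [Fintype A] [Fintype B] [DecidableEq B]
    (ρ : Matrix A A ℂ) (J : Matrix (A × B) (A × B) ℂ) : Matrix (A × B) (A × B) ℂ :=
  jordanProduct (extendA B ρ) J

/-- The set `𝒬(ρ, σ)` of states over time between `ρ` and `σ`: all `ρ ⋆ J`, where `J` is
a Jamiołkowski matrix with `Tr_A[(ρ ⊗ 1) J] = σ`. -/
def statesOverTime {A B : Type*} [Fintype A] [Fintype B] [DecidableEq A] [DecidableEq B]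
    (ρ : Matrix A A ℂ) (σ : Matrix B B ℂ) : Set (Matrix (A × B) (A × B) ℂ) :=
  {Q | ∃ J ∈ jamiolkowskiMatrices A B,
    partialTraceA (extendA B ρ * J) = σ ∧ Q = stateOverTime ρ J}

/-- The cost `Tr[K Q]`. For Hermitian `K` and `Q`, which is the case for every state over
time, this trace is real, so that taking the real part loses nothing. -/
def planCost {I : Type*} [Fintype I] (K Q : Matrix I I ℂ) : ℝ := (K * Q).trace.re

/-- The quantum transport cost with cost matrix `K`: the minimum of `Tr[K Q]` over all
states over time between `ρ` and `σ`. -/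
def transportCost {A B : Type*} [Fintype A] [Fintype B] [DecidableEq A] [DecidableEq B]
    (K : Matrix (A × B) (A × B) ℂ) (ρ : Matrix A A ℂ) (σ : Matrix B B ℂ) : ℝ :=
  sInf (planCost K '' statesOverTime ρ σ)

/-- The unitarily invariant cost matrix `K₀ = d 1 - S`, with `d` the dimension. -/
def unitaryInvariantCostMatrix (A : Type*) [Fintype A] [DecidableEq A] :
    Matrix (A × A) (A × A) ℂ :=
  (Fintype.card A : ℂ) • (1 : Matrix (A × A) (A × A) ℂ) - swapOperator A

/-- The Jamiołkowski matrix `(id ⊗ E)(S) = ∑ i j, |i⟩⟨j| ⊗ E(|j⟩⟨i|)` of a linear map. -/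
def jamiolkowski {A B : Type*} [DecidableEq A]
    (E : Matrix A A ℂ →ₗ[ℂ] Matrix B B ℂ) : Matrix (A × B) (A × B) ℂ :=
  Matrix.of fun p q => E (Matrix.single q.1 p.1 1) p.2 q.2

/-- `E` is an optimal channel for the transport problem with cost matrix `K` from `ρ`
to `σ`: it is completely positive and trace preserving (expressed through its Jamiołkowski
matrix), maps `ρ` to `σ`, and its state over time minimises the cost. -/
def IsOptimalChannel {A B : Type*} [Fintype A] [Fintype B] [DecidableEq A] [DecidableEq B]
    (K : Matrix (A × B) (A × B) ℂ) (ρ : Matrix A A ℂ) (σ : Matrix B B ℂ)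
    (E : Matrix A A ℂ →ₗ[ℂ] Matrix B B ℂ) : Prop :=
  jamiolkowski E ∈ jamiolkowskiMatrices A B ∧ E ρ = σ ∧
    ∀ Q ∈ statesOverTime ρ σ, planCost K (stateOverTime ρ (jamiolkowski E)) ≤ planCost K Q

/-- The map `X ↦ U X U*`. -/
def conjugation {A : Type*} [Fintype A] (U : Matrix A A ℂ) :
    Matrix A A ℂ →ₗ[ℂ] Matrix A A ℂ where
  toFun X := U * X * Uᴴ
  map_add' X Y := by rw [Matrix.mul_add, Matrix.add_mul]
  map_smul' c X := by simp

/-- The operator `|v⟩⟨v|`. -/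
def ketbra {A : Type*} (v : A → ℂ) : Matrix A A ℂ := Matrix.vecMulVec v (star v)

/-- The basis vector `|0⟩` of `ℂ^d = ℂ² ⊕ ℂ^(d-2)`. -/
def ketZero (d : ℕ) : Fin 2 ⊕ Fin (d - 2) → ℂ := Sum.elim ![1, 0] 0

/-- The vector `α |0⟩ + √(1 - α²) |1⟩` of `ℂ^d = ℂ² ⊕ ℂ^(d-2)`. -/
def ketAngle (d : ℕ) (α : ℝ) : Fin 2 ⊕ Fin (d - 2) → ℂ :=
  Sum.elim ![(α : ℂ), (Real.sqrt (1 - α ^ 2) : ℂ)] 0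

/-- The matrix `[[α, -√(1 - α²)], [√(1 - α²), α]] ⊕ 1_(d-2)`. -/
def rotationUnitary (d : ℕ) (α : ℝ) :
    Matrix (Fin 2 ⊕ Fin (d - 2)) (Fin 2 ⊕ Fin (d - 2)) ℂ :=
  Matrix.fromBlocks
    !![(α : ℂ), -(Real.sqrt (1 - α ^ 2) : ℂ); (Real.sqrt (1 - α ^ 2) : ℂ), (α : ℂ)] 0 0 1

end

/-! Let `C = partialTransposeA J` be the Choi matrix of a plan. For the input |0⟩⟨0| the cost is d -
∑ₐ Re C((a,a),(0,0)), so only one column of `C` matters. Since the output of |0⟩ is the pure state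
φ, positivity makes `C` split as x x* + R with R ≥ 0, where R does not meet the rows and columns of
|0⟩. Here x is a Kraus operator K in vectorised form, x(a,k) = K(k,a), with K|0⟩ = φ. As φ₀ = α, the
cost equals d - α Re Tr K.

Trace preservation makes K|1⟩ orthogonal to φ and bounds every column of K by 1. In standard
position this gives K₀₀ = α, |K₁₁| ≤ α and |Kᵢᵢ| ≤ 1 otherwise, so Re Tr K ≤ 2α + d - 2. The cost is
therefore at least d - α(2α + d - 2) = (1 - α)(d + 2α), and the rotation attains this. If α > 0,
equality fixes the diagonal of K, the column bounds then fix the other entries, and K is the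
rotation. Its columns are unit vectors, so no trace is left for R and R = 0. The carrying lemmas are
`exists_dominant_kraus`, `planCost_stateOverTime_ketbra_single` and `standard_plan`.

For arbitrary pure states, K₀ commutes with V ⊗ V, so simultaneous conjugation by a unitary V
preserves the problem. A phase and a change of orthonormal basis reach the standard position. -/

/-! ### Choi matrices with a pure output, and the cost for a basis state -/

section Kraus

variable {I n : Type*} [Fintype I] [DecidableEq I] [Fintype n] [DecidableEq n]

/-- The difference is the congruence P* C P with P = 1 - w (Cw)*. The normalisation of w makes two
of the three rank-one terms cancel. -/
theorem Matrix.PosSemidef.sub_vecMulVec_mulVec {C : Matrix I I ℂ} (hC : C.PosSemidef)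
    {w : I → ℂ} (hw : star w ⬝ᵥ (C *ᵥ w) = 1) :
    (C - vecMulVec (C *ᵥ w) (star (C *ᵥ w))).PosSemidef := by
  have h := hC.conjTranspose_mul_mul_same (1 - vecMulVec w (star (C *ᵥ w)))
  convert h using 1
  have h1 : vecMulVec (C *ᵥ w) (star w) * C = vecMulVec (C *ᵥ w) (star (C *ᵥ w)) := by
    rw [vecMulVec_mul, star_mulVec, hC.isHermitian.eq]
  have h2 : vecMulVec (C *ᵥ w) (star (C *ᵥ w)) * vecMulVec w (star (C *ᵥ w))
      = vecMulVec (C *ᵥ w) (star (C *ᵥ w)) := by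
    rw [vecMulVec_mul_vecMulVec, star_mulVec, hC.isHermitian.eq, ← dotProduct_mulVec, hw, one_smul]
  have h3 : C * vecMulVec w (star (C *ᵥ w)) = vecMulVec (C *ᵥ w) (star (C *ᵥ w)) := by
    rw [mul_vecMulVec]
  rw [conjTranspose_sub, conjTranspose_one, conjTranspose_vecMulVec, star_star, sub_mul, sub_mul,
    one_mul, h1, mul_sub, mul_sub, mul_one, mul_one, h2, h3]
  abel

theorem Matrix.PosSemidef.apply_eq_zero_of_diag_eq_zero {R : Matrix I I ℂ} (hR : R.PosSemidef)
    {q : I} (hq : R q q = 0) (p : I) : R p q = 0 := by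
  have h := (hR.dotProduct_mulVec_zero_iff (Pi.single q 1)).1 (by
    simp [hq])
  simpa using congrFun h p

theorem Matrix.PosSemidef.eq_zero_of_diag_eq_zero {R : Matrix I I ℂ} (hR : R.PosSemidef)
    (h : ∀ q, R q q = 0) : R = 0 := by
  ext p q
  exact hR.apply_eq_zero_of_diag_eq_zero (h q) p

/-- A Choi matrix whose channel sends the basis state `z` to the pure state `φ` splits off
a single Kraus operator, here in vectorised form `x`, that carries the whole output of `z`. -/
theorem exists_dominant_kraus {C : Matrix (n × n) (n × n) ℂ} (hC : C.PosSemidef)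
    (htr : ∀ i j, ∑ k, C (i, k) (j, k) = if i = j then 1 else 0) {z : n} {φ : n → ℂ}
    (hφ : star φ ⬝ᵥ φ = 1) (hz : ∀ k l, C (z, k) (z, l) = φ k * star (φ l)) :
    ∃ x : n × n → ℂ, (C - vecMulVec x (star x)).PosSemidef ∧ (∀ k, x (z, k) = φ k) ∧
      (∀ p l, C p (z, l) = x p * star (φ l)) ∧
      (∀ i, i ≠ z → ∑ k, x (i, k) * star (φ k) = 0) ∧
      (∀ i, ∑ k, ‖x (i, k)‖ ^ 2 ≤ 1) := by
  -- Here w = |z⟩ ⊗ φ. If C = ∑ xₘ xₘ* with Kraus operators Kₘ, purity gives Kₘ|z⟩ = cₘ φ, and C w =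
  -- ∑ c̄ₘ xₘ is the combination that collects the whole output of z.
  set w : n × n → ℂ := fun p => if p.1 = z then φ p.2 else 0 with hw
  have hx : ∀ p, (C *ᵥ w) p = ∑ l, C p (z, l) * φ l := by
    intro p
    simp [mulVec, dotProduct, Fintype.sum_prod_type, hw, mul_ite, Finset.sum_ite_irrel]
  have hxz : ∀ k, (C *ᵥ w) (z, k) = φ k := by
    intro k
    rw [hx]
    simp only [hz, mul_assoc]
    rw [← Finset.mul_sum]
    have : ∑ i, star (φ i) * φ i = 1 := hφ
    rw [this, mul_one]
  have hww : star w ⬝ᵥ (C *ᵥ w) = 1 := by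
    rw [← hφ]
    simp only [dotProduct, Fintype.sum_prod_type]
    rw [Finset.sum_eq_single z]
    · exact Finset.sum_congr rfl fun k _ => by rw [hxz]; simp [hw]
    · intro b _ hb
      simp [hw, hb]
    · simp
  have hR := hC.sub_vecMulVec_mulVec hww
  set x := C *ᵥ w with hxdef
  -- The remainder has zero diagonal on the block of z, so by positivity the corresponding columns
  -- vanish. This determines `C` there.
  have hRz : ∀ l, (C - vecMulVec x (star x)) (z, l) (z, l) = 0 := by
    intro l
    simp [vecMulVec_apply, hz, hxz]
  have hcol : ∀ p l, C p (z, l) = x p * star (φ l) := by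
    intro p l
    have := hR.apply_eq_zero_of_diag_eq_zero (hRz l) p
    simpa [vecMulVec_apply, hxz, sub_eq_zero] using this
  refine ⟨x, hR, hxz, hcol, ?_, ?_⟩
  · intro i hi
    have := htr i z
    rw [if_neg hi] at this
    simpa [hcol] using this
  · intro i
    -- The norm bound says that the block of the remainder at i has nonnegative trace.
    have h1 : ∀ k, 0 ≤ (C - vecMulVec x (star x)) (i, k) (i, k) := fun k => hR.diag_nonneg
    have h2 : 0 ≤ ∑ k, (C - vecMulVec x (star x)) (i, k) (i, k) := Finset.sum_nonneg fun k _ => h1 k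
    have h3 : ∑ k, (C - vecMulVec x (star x)) (i, k) (i, k)
        = ((1 - ∑ k, ‖x (i, k)‖ ^ 2 : ℝ) : ℂ) := by
      simp only [Matrix.sub_apply, Finset.sum_sub_distrib, htr, if_true, vecMulVec_apply]
      push_cast
      congr 1
      refine Finset.sum_congr rfl fun k _ => ?_
      rw [Pi.star_apply, RCLike.star_def, Complex.mul_conj, Complex.normSq_eq_norm_sq]
      norm_cast
    rw [h3] at h2
    have := Complex.zero_le_real.1 h2
    linarith

theorem extendA_ketbra_single_mul (z : n) (J : Matrix (n × n) (n × n) ℂ) (i k : n) (q : n × n) :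
    (extendA n (ketbra (Pi.single z 1)) * J) (i, k) q = if i = z then J (z, k) q else 0 := by
  simp only [Matrix.mul_apply, Fintype.sum_prod_type, extendA, ketbra, kroneckerMap_apply,
    vecMulVec_apply, Matrix.one_apply, Pi.star_apply]
  rw [Finset.sum_eq_single z]
  · rw [Finset.sum_eq_single k]
    · by_cases h : i = z
      · subst h; simp
      · simp [h]
    · intro b _ hb
      simp [hb.symm]
    · simp
  · intro b _ hb
    simp [hb]
  · simp

theorem partialTraceA_extendA_ketbra_single_mul (z : n) (J : Matrix (n × n) (n × n) ℂ) :
    partialTraceA (extendA n (ketbra (Pi.single z 1)) * J) = of fun k l => J (z, k) (z, l) := by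
  ext k l
  simp [partialTraceA, extendA_ketbra_single_mul]

theorem trace_unitaryInvariantCostMatrix_mul (Q : Matrix (n × n) (n × n) ℂ) :
    (unitaryInvariantCostMatrix n * Q).trace =
      Fintype.card n * Q.trace - ∑ a, ∑ b, Q (b, a) (a, b) := by
  rw [unitaryInvariantCostMatrix, Matrix.sub_mul, Matrix.smul_mul, Matrix.one_mul,
    Matrix.trace_sub, Matrix.trace_smul, smul_eq_mul]
  congr 1
  simp only [Matrix.trace, Matrix.diag, Fintype.sum_prod_type, Matrix.mul_apply, swapOperator,
    of_apply, ite_mul, one_mul, zero_mul]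
  refine Finset.sum_congr rfl fun a _ => Finset.sum_congr rfl fun b _ => ?_
  rw [Finset.sum_eq_single b, Finset.sum_eq_single a]
  · simp
  · intro c _ hc; simp [hc.symm]
  · simp
  · intro c _ hc; simp [hc.symm]
  · simp

/-- The identity part of the cost matrix contributes d by trace preservation. The swap part picks
the entries J((z,a),(a,z)), which are Choi entries in the column (z,z). -/
theorem planCost_stateOverTime_ketbra_single (z : n) {J : Matrix (n × n) (n × n) ℂ}
    (hJ : J ∈ jamiolkowskiMatrices n n) :
    planCost (unitaryInvariantCostMatrix n) (stateOverTime (ketbra (Pi.single z 1)) J) =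
      Fintype.card n - ∑ a, (partialTransposeA J (a, a) (z, z)).re := by
  obtain ⟨hC, htr⟩ := hJ
  have hherm : ∀ p q, star (J p q) = J q p := by
    intro p q
    have := hC.isHermitian.apply (p.1, q.2) (q.1, p.2)
    simpa [partialTransposeA] using this
  set X := extendA n (ketbra (Pi.single z (1 : ℂ))) with hX
  have hXh : Xᴴ = X := by
    rw [hX, extendA, conjTranspose_kronecker, conjTranspose_one, ketbra, conjTranspose_vecMulVec,
      star_star]
  have hJh : Jᴴ = J := by
    ext p q
    rw [conjTranspose_apply, hherm]
  have hK : (unitaryInvariantCostMatrix n)ᴴ = unitaryInvariantCostMatrix n := by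
    ext p q
    simp only [unitaryInvariantCostMatrix, swapOperator, conjTranspose_apply, Matrix.sub_apply,
      Matrix.smul_apply, Matrix.one_apply, of_apply, star_sub, smul_eq_mul, star_mul']
    simp only [apply_ite star, star_one, star_zero, star_natCast, eq_comm (a := q),
      eq_comm (a := q.1), eq_comm (a := q.2), and_comm]
  -- All three factors are Hermitian, so the two halves of the Jordan product have conjugate traces
  -- and equal real parts.
  have hsym : (unitaryInvariantCostMatrix n * (J * X)).trace.re =
      (unitaryInvariantCostMatrix n * (X * J)).trace.re := by
    have : (unitaryInvariantCostMatrix n * (J * X)).trace =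
        star (unitaryInvariantCostMatrix n * (X * J)).trace := by
      rw [← trace_conjTranspose, conjTranspose_mul, conjTranspose_mul, hXh, hJh, hK, trace_mul_comm]
    rw [this]
    simp
  have hcost : planCost (unitaryInvariantCostMatrix n) (stateOverTime (ketbra (Pi.single z 1)) J) =
      (unitaryInvariantCostMatrix n * (X * J)).trace.re := by
    rw [planCost, stateOverTime, jordanProduct, Matrix.mul_smul, Matrix.mul_add, trace_smul,
      trace_add, smul_eq_mul]
    have h2 : (1 / 2 : ℂ) = ((1 / 2 : ℝ) : ℂ) := by norm_num
    rw [h2, Complex.re_ofReal_mul, Complex.add_re, hsym]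
    ring
  rw [hcost, trace_unitaryInvariantCostMatrix_mul]
  have htrz : (X * J).trace = 1 := by
    have := congrFun (congrFun htr z) z
    simp only [Matrix.one_apply_eq, partialTraceB, of_apply] at this
    simp only [Matrix.trace, Matrix.diag, Fintype.sum_prod_type, hX, extendA_ketbra_single_mul]
    rw [← this]
    rw [Finset.sum_eq_single z]
    · simp
    · intro b _ hb; simp [hb]
    · simp
  rw [htrz, mul_one, Complex.sub_re, Complex.natCast_re, Complex.re_sum]
  congr 1
  refine Finset.sum_congr rfl fun a _ => ?_
  simp [hX, extendA_ketbra_single_mul, partialTransposeA]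

end Kraus

/-! ### Unitary covariance of the transport problem and Jamiołkowski matrices of conjugations -/

section Covariance

open scoped Kronecker

variable {n : Type*} [Fintype n]

theorem partialTransposeA_kronecker_mul_mul (A B A' B' : Matrix n n ℂ)
    (J : Matrix (n × n) (n × n) ℂ) :
    partialTransposeA ((A ⊗ₖ B) * J * (A' ⊗ₖ B')) =
      (A'ᵀ ⊗ₖ B) * partialTransposeA J * (Aᵀ ⊗ₖ B') := by
  ext ⟨i, k⟩ ⟨j, l⟩
  simp only [partialTransposeA, of_apply, Matrix.mul_apply, Fintype.sum_prod_type,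
    kroneckerMap_apply, Finset.sum_mul, transpose_apply]
  calc _ = ∑ a, ∑ b, ∑ c, ∑ e, A j c * B k e * J (c, e) (a, b) * (A' a i * B' b l) := rfl
    _ = ∑ a, ∑ c, ∑ b, ∑ e, A j c * B k e * J (c, e) (a, b) * (A' a i * B' b l) :=
      Finset.sum_congr rfl fun a _ => Finset.sum_comm
    _ = ∑ c, ∑ a, ∑ b, ∑ e, A j c * B k e * J (c, e) (a, b) * (A' a i * B' b l) :=
      Finset.sum_comm
    _ = ∑ c, ∑ b, ∑ a, ∑ e, A j c * B k e * J (c, e) (a, b) * (A' a i * B' b l) :=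
      Finset.sum_congr rfl fun a _ => Finset.sum_comm
    _ = _ := by
      refine Finset.sum_congr rfl fun c _ => Finset.sum_congr rfl fun b _ =>
        Finset.sum_congr rfl fun a _ => Finset.sum_congr rfl fun e _ => ?_
      ring

theorem ketbra_mulVec (V : Matrix n n ℂ) (v : n → ℂ) :
    ketbra (V *ᵥ v) = V * ketbra v * Vᴴ := by
  rw [ketbra, ketbra, mul_vecMulVec, vecMulVec_mul, star_mulVec]

variable [DecidableEq n]

theorem partialTraceA_one_kronecker_mul_mul (B B' : Matrix n n ℂ)
    (J : Matrix (n × n) (n × n) ℂ) :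
    partialTraceA (((1 : Matrix n n ℂ) ⊗ₖ B) * J * ((1 : Matrix n n ℂ) ⊗ₖ B')) =
      B * partialTraceA J * B' := by
  ext k l
  simp only [partialTraceA, of_apply, Matrix.mul_apply, Fintype.sum_prod_type,
    kroneckerMap_apply, Finset.sum_mul, Finset.mul_sum, Matrix.one_apply, ite_mul, mul_ite,
    one_mul, zero_mul, mul_zero, Finset.sum_ite_irrel, Finset.sum_const_zero, Finset.sum_ite_eq,
    Finset.sum_ite_eq', Finset.mem_univ, if_true]
  rw [Finset.sum_comm]
  exact Finset.sum_congr rfl fun b _ => Finset.sum_comm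

theorem partialTraceB_kronecker_one_mul_mul (A A' : Matrix n n ℂ)
    (J : Matrix (n × n) (n × n) ℂ) :
    partialTraceB ((A ⊗ₖ (1 : Matrix n n ℂ)) * J * (A' ⊗ₖ (1 : Matrix n n ℂ))) =
      A * partialTraceB J * A' := by
  ext k l
  simp only [partialTraceB, of_apply, Matrix.mul_apply, Fintype.sum_prod_type,
    kroneckerMap_apply, Finset.sum_mul, Finset.mul_sum, Matrix.one_apply, ite_mul, mul_ite,
    mul_one, zero_mul, mul_zero,
    Finset.sum_ite_eq, Finset.sum_ite_eq', Finset.mem_univ, if_true]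
  rw [Finset.sum_comm]
  exact Finset.sum_congr rfl fun b _ => Finset.sum_comm

theorem partialTraceA_kronecker_one_mul_comm (A : Matrix n n ℂ)
    (J : Matrix (n × n) (n × n) ℂ) :
    partialTraceA ((A ⊗ₖ (1 : Matrix n n ℂ)) * J) =
      partialTraceA (J * (A ⊗ₖ (1 : Matrix n n ℂ))) := by
  ext k l
  simp only [partialTraceA, of_apply, Matrix.mul_apply, Fintype.sum_prod_type,
    kroneckerMap_apply, Matrix.one_apply, ite_mul, mul_ite,
    mul_one, zero_mul, mul_zero,
    Finset.sum_ite_eq, Finset.sum_ite_eq', Finset.mem_univ, if_true]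
  rw [Finset.sum_comm]
  exact Finset.sum_congr rfl fun b _ => Finset.sum_congr rfl fun c _ => mul_comm _ _

theorem partialTraceB_one_kronecker_mul_comm (B : Matrix n n ℂ)
    (J : Matrix (n × n) (n × n) ℂ) :
    partialTraceB (((1 : Matrix n n ℂ) ⊗ₖ B) * J) =
      partialTraceB (J * ((1 : Matrix n n ℂ) ⊗ₖ B)) := by
  ext k l
  simp only [partialTraceB, of_apply, Matrix.mul_apply, Fintype.sum_prod_type,
    kroneckerMap_apply, Matrix.one_apply, ite_mul, mul_ite,
    one_mul, zero_mul, mul_zero, Finset.sum_ite_irrel, Finset.sum_const_zero,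
    Finset.sum_ite_eq, Finset.sum_ite_eq', Finset.mem_univ, if_true]
  rw [Finset.sum_comm]
  exact Finset.sum_congr rfl fun b _ => Finset.sum_congr rfl fun c _ => mul_comm _ _

theorem kronecker_self_mul_conjTranspose {V : Matrix n n ℂ} (hV : V * Vᴴ = 1) :
    (V ⊗ₖ V) * (V ⊗ₖ V)ᴴ = 1 := by
  rw [conjTranspose_kronecker, ← mul_kronecker_mul, hV, one_kronecker_one]

/-- The trace over A is cyclic for operators acting on A alone, so the V on that factor moves to the
right and cancels against its adjoint. -/
theorem partialTraceA_kronecker_conj {V : Matrix n n ℂ} (hV : V * Vᴴ = 1)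
    (J : Matrix (n × n) (n × n) ℂ) :
    partialTraceA ((V ⊗ₖ V) * J * (V ⊗ₖ V)ᴴ) = V * partialTraceA J * Vᴴ := by
  have h1 : V ⊗ₖ V = (V ⊗ₖ (1 : Matrix n n ℂ)) * ((1 : Matrix n n ℂ) ⊗ₖ V) := by
    rw [← mul_kronecker_mul, one_mul, mul_one]
  have h2 : (V ⊗ₖ V)ᴴ * (V ⊗ₖ (1 : Matrix n n ℂ)) = ((1 : Matrix n n ℂ) ⊗ₖ Vᴴ) := by
    rw [conjTranspose_kronecker, ← mul_kronecker_mul, mul_eq_one_comm.1 hV, mul_one]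
  conv_lhs => rw [h1, Matrix.mul_assoc, Matrix.mul_assoc, partialTraceA_kronecker_one_mul_comm,
    ← h1, Matrix.mul_assoc, Matrix.mul_assoc, h2, ← Matrix.mul_assoc]
  exact partialTraceA_one_kronecker_mul_mul V Vᴴ J

theorem partialTraceB_kronecker_conj {V : Matrix n n ℂ} (hV : V * Vᴴ = 1)
    (J : Matrix (n × n) (n × n) ℂ) :
    partialTraceB ((V ⊗ₖ V) * J * (V ⊗ₖ V)ᴴ) = V * partialTraceB J * Vᴴ := by
  have h1 : V ⊗ₖ V = ((1 : Matrix n n ℂ) ⊗ₖ V) * (V ⊗ₖ (1 : Matrix n n ℂ)) := by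
    rw [← mul_kronecker_mul, one_mul, mul_one]
  have h2 : (V ⊗ₖ V)ᴴ * ((1 : Matrix n n ℂ) ⊗ₖ V) = (Vᴴ ⊗ₖ (1 : Matrix n n ℂ)) := by
    rw [conjTranspose_kronecker, ← mul_kronecker_mul, mul_eq_one_comm.1 hV, mul_one]
  conv_lhs => rw [h1, Matrix.mul_assoc, Matrix.mul_assoc, partialTraceB_one_kronecker_mul_comm,
    ← h1, Matrix.mul_assoc, Matrix.mul_assoc, h2, ← Matrix.mul_assoc]
  exact partialTraceB_kronecker_one_mul_mul V Vᴴ J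

theorem swapOperator_mul_kronecker (A B : Matrix n n ℂ) :
    swapOperator n * (A ⊗ₖ B) = (B ⊗ₖ A) * swapOperator n := by
  ext ⟨i, k⟩ ⟨j, l⟩
  simp [swapOperator, Matrix.mul_apply, Fintype.sum_prod_type, ite_and, mul_comm]

theorem unitaryInvariantCostMatrix_mul_kronecker_self (V : Matrix n n ℂ) :
    unitaryInvariantCostMatrix n * (V ⊗ₖ V) = (V ⊗ₖ V) * unitaryInvariantCostMatrix n := by
  rw [unitaryInvariantCostMatrix, Matrix.sub_mul, Matrix.mul_sub, swapOperator_mul_kronecker]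
  simp

theorem planCost_kronecker_conj {V : Matrix n n ℂ} (hV : V * Vᴴ = 1)
    (Q : Matrix (n × n) (n × n) ℂ) :
    planCost (unitaryInvariantCostMatrix n) ((V ⊗ₖ V) * Q * (V ⊗ₖ V)ᴴ) =
      planCost (unitaryInvariantCostMatrix n) Q := by
  rw [planCost, planCost, ← Matrix.mul_assoc, ← Matrix.mul_assoc,
    unitaryInvariantCostMatrix_mul_kronecker_self, trace_mul_comm, ← Matrix.mul_assoc,
    ← Matrix.mul_assoc, mul_eq_one_comm.1 (kronecker_self_mul_conjTranspose hV), Matrix.one_mul]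

theorem extendA_conj {V : Matrix n n ℂ} (hV : V * Vᴴ = 1) (ρ : Matrix n n ℂ) :
    extendA n (V * ρ * Vᴴ) = (V ⊗ₖ V) * extendA n ρ * (V ⊗ₖ V)ᴴ := by
  change (V * ρ * Vᴴ) ⊗ₖ (1 : Matrix n n ℂ) = (V ⊗ₖ V) * (ρ ⊗ₖ (1 : Matrix n n ℂ)) * (V ⊗ₖ V)ᴴ
  rw [conjTranspose_kronecker, ← mul_kronecker_mul, ← mul_kronecker_mul, Matrix.mul_one, hV]

theorem conj_mul_conj {I : Type*} [Fintype I] [DecidableEq I] {W : Matrix I I ℂ}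
    (hW : W * Wᴴ = 1) (X Y : Matrix I I ℂ) :
    (W * X * Wᴴ) * (W * Y * Wᴴ) = W * (X * Y) * Wᴴ := by
  have h : Wᴴ * W = 1 := mul_eq_one_comm.1 hW
  calc _ = W * X * (Wᴴ * W) * Y * Wᴴ := by simp only [Matrix.mul_assoc]
    _ = _ := by rw [h, Matrix.mul_one]; simp only [Matrix.mul_assoc]

theorem stateOverTime_conj {V : Matrix n n ℂ} (hV : V * Vᴴ = 1) (ρ : Matrix n n ℂ)
    (J : Matrix (n × n) (n × n) ℂ) :
    stateOverTime (V * ρ * Vᴴ) ((V ⊗ₖ V) * J * (V ⊗ₖ V)ᴴ) =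
      (V ⊗ₖ V) * stateOverTime ρ J * (V ⊗ₖ V)ᴴ := by
  have hW := kronecker_self_mul_conjTranspose hV
  rw [stateOverTime, stateOverTime, jordanProduct, jordanProduct, extendA_conj hV,
    conj_mul_conj hW, conj_mul_conj hW, Matrix.mul_smul, Matrix.smul_mul, Matrix.mul_add,
    Matrix.add_mul]

/-- Partial transposition turns conjugation by V ⊗ V into conjugation by V̄ ⊗ V, which is still a
congruence and preserves positivity. -/
theorem kronecker_conj_mem_jamiolkowskiMatrices {V : Matrix n n ℂ} (hV : V * Vᴴ = 1)
    {J : Matrix (n × n) (n × n) ℂ} (hJ : J ∈ jamiolkowskiMatrices n n) :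
    (V ⊗ₖ V) * J * (V ⊗ₖ V)ᴴ ∈ jamiolkowskiMatrices n n := by
  refine ⟨?_, ?_⟩
  · rw [conjTranspose_kronecker, partialTransposeA_kronecker_mul_mul]
    have h : Vᵀ ⊗ₖ Vᴴ = (Vᴴᵀ ⊗ₖ V)ᴴ := by
      rw [conjTranspose_kronecker]
      congr 1
      ext i j
      simp
    rw [h]
    exact hJ.1.mul_mul_conjTranspose_same _
  · rw [partialTraceB_kronecker_conj hV, hJ.2, Matrix.mul_one, hV]

theorem kronecker_conj_mem_statesOverTime {V : Matrix n n ℂ} (hV : V * Vᴴ = 1)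
    {ρ σ : Matrix n n ℂ} {Q : Matrix (n × n) (n × n) ℂ} (hQ : Q ∈ statesOverTime ρ σ) :
    (V ⊗ₖ V) * Q * (V ⊗ₖ V)ᴴ ∈ statesOverTime (V * ρ * Vᴴ) (V * σ * Vᴴ) := by
  obtain ⟨J, hJ, hJσ, rfl⟩ := hQ
  refine ⟨_, kronecker_conj_mem_jamiolkowskiMatrices hV hJ, ?_, (stateOverTime_conj hV ρ J).symm⟩
  rw [extendA_conj hV, conj_mul_conj (kronecker_self_mul_conjTranspose hV),
    partialTraceA_kronecker_conj hV, hJσ]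

theorem conjTranspose_conj_conj {V : Matrix n n ℂ} (hV : V * Vᴴ = 1) (ρ : Matrix n n ℂ) :
    Vᴴ * (V * ρ * Vᴴ) * Vᴴᴴ = ρ := by
  have h : Vᴴ * V = 1 := mul_eq_one_comm.1 hV
  calc _ = (Vᴴ * V) * ρ * (Vᴴ * V) := by
        rw [conjTranspose_conjTranspose]; simp only [Matrix.mul_assoc]
    _ = ρ := by rw [h, Matrix.mul_one, Matrix.one_mul]

theorem planCost_image_statesOverTime_conj_subset {V : Matrix n n ℂ} (hV : V * Vᴴ = 1)
    (ρ σ : Matrix n n ℂ) :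
    planCost (unitaryInvariantCostMatrix n) '' statesOverTime ρ σ ⊆
      planCost (unitaryInvariantCostMatrix n) '' statesOverTime (V * ρ * Vᴴ) (V * σ * Vᴴ) := by
  rintro _ ⟨Q, hQ, rfl⟩
  exact ⟨_, kronecker_conj_mem_statesOverTime hV hQ, planCost_kronecker_conj hV Q⟩

/-- The inclusion of cost sets for V and the one for V* give equality of the sets, so nothing about
the infimum is needed. -/
theorem transportCost_conj {V : Matrix n n ℂ} (hV : V * Vᴴ = 1) (ρ σ : Matrix n n ℂ) :
    transportCost (unitaryInvariantCostMatrix n) (V * ρ * Vᴴ) (V * σ * Vᴴ) =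
      transportCost (unitaryInvariantCostMatrix n) ρ σ := by
  have hV' : Vᴴ * Vᴴᴴ = 1 := by
    rw [conjTranspose_conjTranspose]; exact mul_eq_one_comm.1 hV
  have h := planCost_image_statesOverTime_conj_subset hV' (V * ρ * Vᴴ) (V * σ * Vᴴ)
  rw [conjTranspose_conj_conj hV, conjTranspose_conj_conj hV] at h
  rw [transportCost, transportCost,
    h.antisymm (planCost_image_statesOverTime_conj_subset hV ρ σ)]

theorem jamiolkowski_conjugation (U : Matrix n n ℂ) :
    jamiolkowski (conjugation U) =
      ((1 : Matrix n n ℂ) ⊗ₖ U) * swapOperator n * ((1 : Matrix n n ℂ) ⊗ₖ Uᴴ) := by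
  ext ⟨i, k⟩ ⟨j, l⟩
  simp [jamiolkowski, conjugation, swapOperator, Matrix.mul_apply, Fintype.sum_prod_type, ite_and,
    Matrix.one_apply, Matrix.single_apply]

/-- The swap exchanges tensor factors: the inner V and V* on factor B pass through it and reappear
on factor A. Unitarity of V plays no role. -/
theorem jamiolkowski_conjugation_conj {V : Matrix n n ℂ} (U : Matrix n n ℂ) :
    jamiolkowski (conjugation (V * U * Vᴴ)) =
      (V ⊗ₖ V) * jamiolkowski (conjugation U) * (V ⊗ₖ V)ᴴ := by
  set e : Matrix n n ℂ := 1
  calc jamiolkowski (conjugation (V * U * Vᴴ))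
      = (e ⊗ₖ (V * U * Vᴴ)) * swapOperator n * (e ⊗ₖ (V * U * Vᴴ)ᴴ) :=
        jamiolkowski_conjugation _
    _ = (e ⊗ₖ (V * U * Vᴴ)) * (swapOperator n * (e ⊗ₖ V)) * (e ⊗ₖ (Uᴴ * Vᴴ)) := by
        rw [← Matrix.mul_assoc, Matrix.mul_assoc _ (e ⊗ₖ V), ← mul_kronecker_mul, one_mul,
          conjTranspose_mul, conjTranspose_mul, conjTranspose_conjTranspose]
    _ = (V ⊗ₖ (V * U)) * ((e ⊗ₖ Vᴴ) * swapOperator n) * (e ⊗ₖ (Uᴴ * Vᴴ)) := by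
        rw [swapOperator_mul_kronecker, ← Matrix.mul_assoc, ← Matrix.mul_assoc,
          ← mul_kronecker_mul, ← mul_kronecker_mul, one_mul, mul_one, mul_one]
    _ = (V ⊗ₖ (V * U)) * swapOperator n * (Vᴴ ⊗ₖ (Uᴴ * Vᴴ)) := by
        rw [← swapOperator_mul_kronecker, ← Matrix.mul_assoc, Matrix.mul_assoc _ (Vᴴ ⊗ₖ e),
          ← mul_kronecker_mul, one_mul, mul_one]
    _ = _ := by
        rw [jamiolkowski_conjugation, conjTranspose_kronecker]
        have h1 : V ⊗ₖ (V * U) = (V ⊗ₖ V) * (e ⊗ₖ U) := by rw [← mul_kronecker_mul, mul_one]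
        have h2 : Vᴴ ⊗ₖ (Uᴴ * Vᴴ) = (e ⊗ₖ Uᴴ) * (Vᴴ ⊗ₖ Vᴴ) := by
          rw [← mul_kronecker_mul, one_mul]
        rw [h1, h2]
        simp only [Matrix.mul_assoc]
        rfl

theorem partialTransposeA_jamiolkowski_conjugation (U : Matrix n n ℂ) :
    partialTransposeA (jamiolkowski (conjugation U)) =
      vecMulVec (fun p => U p.2 p.1) (star fun p => U p.2 p.1) := by
  ext ⟨i, k⟩ ⟨j, l⟩
  simp [partialTransposeA, jamiolkowski, conjugation, Matrix.mul_apply, Matrix.single_apply,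
    vecMulVec_apply, ite_and]

theorem jamiolkowski_conjugation_mem {U : Matrix n n ℂ} (hU : Uᴴ * U = 1) :
    jamiolkowski (conjugation U) ∈ jamiolkowskiMatrices n n := by
  refine ⟨?_, ?_⟩
  · rw [partialTransposeA_jamiolkowski_conjugation]
    exact posSemidef_vecMulVec_self_star _
  · ext i j
    have h := congrFun (congrFun hU i) j
    rw [← h]
    simp [partialTraceB, jamiolkowski, conjugation, Matrix.mul_apply, Matrix.single_apply, ite_and,
      mul_comm]

/-- This recovers a linear map from its matrix: it identifies the marginal constraint with E ρ = σ
and yields injectivity. -/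
theorem partialTraceA_extendA_mul_jamiolkowski (ρ : Matrix n n ℂ)
    (E : Matrix n n ℂ →ₗ[ℂ] Matrix n n ℂ) :
    partialTraceA (extendA n ρ * jamiolkowski E) = E ρ := by
  ext k l
  conv_rhs => rw [matrix_eq_sum_single ρ]
  simp only [map_sum, Matrix.sum_apply]
  simp only [partialTraceA, of_apply, Matrix.mul_apply, Fintype.sum_prod_type, extendA,
    kroneckerMap_apply, Matrix.one_apply, jamiolkowski, mul_ite, ite_mul, mul_one, mul_zero,
    zero_mul, Finset.sum_ite_eq, Finset.mem_univ, if_true]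
  refine Finset.sum_congr rfl fun i _ => Finset.sum_congr rfl fun j _ => ?_
  have : single i j (ρ i j) = ρ i j • single i j (1 : ℂ) := by simp
  rw [this, map_smul, Matrix.smul_apply, smul_eq_mul]

theorem jamiolkowski_injective :
    Function.Injective (jamiolkowski : (Matrix n n ℂ →ₗ[ℂ] Matrix n n ℂ) → _) := by
  intro E F h
  refine LinearMap.ext fun ρ => ?_
  rw [← partialTraceA_extendA_mul_jamiolkowski ρ E, h, partialTraceA_extendA_mul_jamiolkowski]

theorem partialTransposeA_injective {A B : Type*} :
    Function.Injective (partialTransposeA (A := A) (B := B)) := by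
  intro X Y h
  ext p q
  exact congrFun (congrFun h (q.1, p.2)) (p.1, q.2)

end Covariance

/-! ### Moving two pure states to standard position -/

section StandardPosition

theorem star_dotProduct_comm_of_eq {n : Type*} [Fintype n] {u v : n → ℂ} {c : ℂ}
    (h : star u ⬝ᵥ v = c) : star v ⬝ᵥ u = star c := by
  rw [← h, ← star_dotProduct_star, star_star]

theorem exists_orthonormalBasis_of_overlap {n : Type*} [Fintype n] {i₀ i₁ : n}
    (hi : i₀ ≠ i₁) {ψ φ : n → ℂ} (hψ : star ψ ⬝ᵥ ψ = 1) (hφ : star φ ⬝ᵥ φ = 1) {α : ℝ}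
    (hα0 : 0 ≤ α) (hα1 : α ≤ 1) (hα : star ψ ⬝ᵥ φ = α) :
    ∃ b : OrthonormalBasis n ℂ (EuclideanSpace ℂ n), (b i₀).ofLp = ψ ∧
      φ = (α : ℂ) • ψ + ((√(1 - α ^ 2) : ℝ) : ℂ) • (b i₁).ofLp := by
  classical
  set s : ℝ := √(1 - α ^ 2) with hs
  have hs2 : s ^ 2 = 1 - α ^ 2 := Real.sq_sqrt (by nlinarith)
  have hα' : star φ ⬝ᵥ ψ = α := by simpa using star_dotProduct_comm_of_eq hα
  have hcard : Module.finrank ℂ (EuclideanSpace ℂ n) = Fintype.card n := finrank_euclideanSpace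
  -- If s = 0 then φ = ψ, and the second basis vector is arbitrary because its coefficient vanishes.
  -- Otherwise it is the normalised component χ of φ orthogonal to ψ.
  by_cases h0 : s = 0
  · have hα2 : α = 1 := by
      rw [h0] at hs2; nlinarith
    have hφψ : φ = ψ := by
      have : star (φ - ψ) ⬝ᵥ (φ - ψ) = 0 := by
        rw [star_sub, sub_dotProduct, dotProduct_sub, dotProduct_sub, hψ, hφ, hα, hα', hα2]
        simp
      exact sub_eq_zero.1 (dotProduct_star_self_eq_zero.1 this)
    have horth : Orthonormal ℂ (({i₀} : Set n).domRestrict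
        fun _ => (WithLp.toLp 2 ψ : EuclideanSpace ℂ n)) := by
      rw [orthonormal_iff_ite]
      intro i j
      rw [if_pos (Subsingleton.elim i j)]
      change inner ℂ (WithLp.toLp 2 ψ : EuclideanSpace ℂ n) (WithLp.toLp 2 ψ) = 1
      rw [EuclideanSpace.inner_eq_star_dotProduct, dotProduct_comm, hψ]
    obtain ⟨b, hb⟩ := horth.exists_orthonormalBasis_extension_of_card_eq hcard
    exact ⟨b, by rw [hb _ rfl], by rw [hφψ, hα2, h0]; simp⟩
  · set χ : n → ℂ := (s : ℂ)⁻¹ • (φ - (α : ℂ) • ψ) with hχ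
    have hsC : (s : ℂ) ≠ 0 := by exact_mod_cast h0
    have hψχ : star ψ ⬝ᵥ χ = 0 := by
      rw [hχ, dotProduct_smul, dotProduct_sub, dotProduct_smul, hψ, hα]; simp
    have hχψ : star χ ⬝ᵥ ψ = 0 := by simpa using star_dotProduct_comm_of_eq hψχ
    have hχχ : star χ ⬝ᵥ χ = 1 := by
      have h1 : star χ ⬝ᵥ φ = s := by
        rw [hχ, star_smul, smul_dotProduct, star_sub, star_smul, sub_dotProduct, smul_dotProduct,
          hφ, hα]
        simp only [star_inv₀, RCLike.star_def, Complex.conj_ofReal, smul_eq_mul]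
        have : (s : ℂ) ^ 2 = 1 - (α : ℂ) ^ 2 := by exact_mod_cast hs2
        field_simp
        rw [this]
      nth_rewrite 2 [hχ]
      rw [dotProduct_smul, dotProduct_sub, dotProduct_smul, hχψ, h1]
      simp [hsC]
    have horth : Orthonormal ℂ (({i₀, i₁} : Set n).domRestrict
        fun i => (WithLp.toLp 2 (if i = i₀ then ψ else χ) : EuclideanSpace ℂ n)) := by
      rw [orthonormal_iff_ite]
      rintro ⟨i, hi'⟩ ⟨j, hj'⟩
      change inner ℂ (WithLp.toLp 2 (if i = i₀ then ψ else χ) : EuclideanSpace ℂ n)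
        (WithLp.toLp 2 (if j = i₀ then ψ else χ)) = _
      rw [EuclideanSpace.inner_eq_star_dotProduct, dotProduct_comm]
      simp only [Subtype.mk.injEq]
      rcases hi' with rfl | hi' <;> rcases hj' with rfl | hj'
      · simp [hψ]
      · obtain rfl : j = i₁ := hj'
        simp [hi, hi.symm, hψχ]
      · obtain rfl : i = i₁ := hi'
        simp [hi.symm, hχψ]
      · obtain rfl : i = i₁ := hi'
        obtain rfl : j = i := hj'
        simp [hi.symm, hχχ]
    obtain ⟨b, hb⟩ := horth.exists_orthonormalBasis_extension_of_card_eq hcard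
    refine ⟨b, by rw [hb _ (Or.inl rfl)]; simp, ?_⟩
    rw [hb _ (Or.inr rfl)]
    simp only [if_neg hi.symm, hχ]
    rw [smul_smul, mul_inv_cancel₀ hsC, one_smul]
    abel

/-- Two unit vectors with nonnegative overlap `α` are brought into standard position by a
unitary matrix. -/
theorem exists_unitary_mulVec_eq (d : ℕ) {ψ φ : Fin 2 ⊕ Fin (d - 2) → ℂ}
    (hψ : star ψ ⬝ᵥ ψ = 1) (hφ : star φ ⬝ᵥ φ = 1) {α : ℝ} (hα0 : 0 ≤ α) (hα1 : α ≤ 1)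
    (hα : star ψ ⬝ᵥ φ = α) :
    ∃ V : Matrix (Fin 2 ⊕ Fin (d - 2)) (Fin 2 ⊕ Fin (d - 2)) ℂ, V * Vᴴ = 1 ∧
      V *ᵥ ψ = ketZero d ∧ V *ᵥ φ = ketAngle d α := by
  obtain ⟨b, hb0, hb1⟩ := exists_orthonormalBasis_of_overlap
    (i₀ := Sum.inl 0) (i₁ := Sum.inl 1) (by simp) hψ hφ hα0 hα1 hα
  have hbb : ∀ i j, star (b i).ofLp ⬝ᵥ (b j).ofLp = if i = j then 1 else 0 := by
    intro i j
    rw [dotProduct_comm, ← EuclideanSpace.inner_eq_star_dotProduct]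
    exact orthonormal_iff_ite.1 b.orthonormal i j
  set V : Matrix (Fin 2 ⊕ Fin (d - 2)) (Fin 2 ⊕ Fin (d - 2)) ℂ :=
    of fun i j => star ((b i).ofLp j) with hV
  have hVb : ∀ j, V *ᵥ (b j).ofLp = Pi.single j 1 := by
    intro j
    ext i
    rw [Pi.single_apply, ← hbb i j]
    rfl
  have h0 : V *ᵥ ψ = ketZero d := by
    rw [← hb0, hVb]
    ext (i | i)
    · fin_cases i <;> simp [ketZero]
    · simp [ketZero]
  refine ⟨V, ?_, h0, ?_⟩
  · ext i j
    rw [Matrix.one_apply, ← hbb i j]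
    simp [Matrix.mul_apply, dotProduct, hV]
  · rw [hb1, mulVec_add, mulVec_smul, mulVec_smul, h0, hVb]
    ext (i | i)
    · fin_cases i <;> simp [ketZero, ketAngle]
    · simp [ketZero, ketAngle]

theorem norm_star_dotProduct_le_one {n : Type*} [Fintype n] {ψ φ : n → ℂ}
    (hψ : star ψ ⬝ᵥ ψ = 1) (hφ : star φ ⬝ᵥ φ = 1) : ‖star ψ ⬝ᵥ φ‖ ≤ 1 := by
  have hn : ∀ v : n → ℂ, star v ⬝ᵥ v = 1 → ‖(WithLp.toLp 2 v : EuclideanSpace ℂ n)‖ = 1 := by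
    intro v hv
    rw [dotProduct_comm] at hv
    have h := inner_self_eq_norm_sq_to_K (𝕜 := ℂ) (WithLp.toLp 2 v : EuclideanSpace ℂ n)
    rw [EuclideanSpace.inner_eq_star_dotProduct, hv] at h
    have h' : ‖(WithLp.toLp 2 v : EuclideanSpace ℂ n)‖ ^ 2 = 1 :=
      Complex.ofReal_injective (by rw [Complex.ofReal_pow, Complex.ofReal_one]; exact h.symm)
    exact (pow_eq_one_iff_of_nonneg (norm_nonneg _) two_ne_zero).1 h'
  have h := norm_inner_le_norm (𝕜 := ℂ) (WithLp.toLp 2 ψ : EuclideanSpace ℂ n) (WithLp.toLp 2 φ)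
  rwa [EuclideanSpace.inner_eq_star_dotProduct, dotProduct_comm, hn ψ hψ, hn φ hφ, one_mul] at h

theorem exists_phase_mul_eq_norm (z : ℂ) : ∃ c : ℂ, c * star c = 1 ∧ c * z = ‖z‖ := by
  by_cases hz : z = 0
  · exact ⟨1, by simp, by simp [hz]⟩
  · have h : (‖z‖ : ℂ) ≠ 0 := by simpa using hz
    have hzz : z * (starRingEnd ℂ) z = (‖z‖ : ℂ) ^ 2 := by
      rw [Complex.mul_conj, Complex.normSq_eq_norm_sq]; norm_cast
    refine ⟨(starRingEnd ℂ) z / ‖z‖, ?_, ?_⟩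
    · simp only [RCLike.star_def, map_div₀, Complex.conj_conj, Complex.conj_ofReal]
      field_simp
      linear_combination hzz
    · field_simp
      linear_combination hzz

theorem ketbra_smul_of_mul_star_eq_one {n : Type*} {c : ℂ} (hc : c * star c = 1) (v : n → ℂ) :
    ketbra (c • v) = ketbra v := by
  ext i j
  simp only [ketbra, vecMulVec_apply, Pi.smul_apply, Pi.star_apply, smul_eq_mul, star_mul']
  linear_combination v i * star (v j) * hc

/-- Two pure states are brought into standard position by a unitary matrix. -/
theorem exists_unitary_conj_ketbra_eq (d : ℕ) {ψ φ : Fin 2 ⊕ Fin (d - 2) → ℂ}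
    (hψ : star ψ ⬝ᵥ ψ = 1) (hφ : star φ ⬝ᵥ φ = 1) :
    ∃ V : Matrix (Fin 2 ⊕ Fin (d - 2)) (Fin 2 ⊕ Fin (d - 2)) ℂ, V * Vᴴ = 1 ∧
      V * ketbra ψ * Vᴴ = ketbra (ketZero d) ∧
      V * ketbra φ * Vᴴ = ketbra (ketAngle d ‖star ψ ⬝ᵥ φ‖) := by
  -- A phase on φ makes the overlap real and nonnegative without changing the projector.
  obtain ⟨c, hc, hcz⟩ := exists_phase_mul_eq_norm (star ψ ⬝ᵥ φ)
  obtain ⟨V, hV, h0, h1⟩ := exists_unitary_mulVec_eq d (φ := c • φ) hψ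
    (by
      rw [star_smul, smul_dotProduct, dotProduct_smul, hφ, smul_eq_mul, smul_eq_mul, mul_one,
        mul_comm, hc])
    (norm_nonneg (star ψ ⬝ᵥ φ)) (norm_star_dotProduct_le_one hψ hφ)
    (by rw [dotProduct_smul, smul_eq_mul, hcz])
  refine ⟨V, hV, ?_, ?_⟩
  · rw [← ketbra_mulVec, h0]
  · rw [← ketbra_smul_of_mul_star_eq_one hc φ, ← ketbra_mulVec, h1]

end StandardPosition

/-! ### Lower bound, equality case and optimal plan in standard position -/

section StandardCost

variable {d : ℕ} {α : ℝ}

theorem ketZero_eq_single (d : ℕ) : ketZero d = Pi.single (Sum.inl 0) 1 := by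
  ext (i | i)
  · fin_cases i <;> simp [ketZero]
  · simp [ketZero]

theorem sqrt_one_sub_sq_sq (hα0 : 0 ≤ α) (hα1 : α ≤ 1) : (√(1 - α ^ 2)) ^ 2 = 1 - α ^ 2 :=
  Real.sq_sqrt (by nlinarith)

theorem star_ketAngle_dotProduct_self (d : ℕ) (hα0 : 0 ≤ α) (hα1 : α ≤ 1) :
    star (ketAngle d α) ⬝ᵥ ketAngle d α = 1 := by
  have h : ((√(1 - α ^ 2) : ℝ) : ℂ) ^ 2 = 1 - (α : ℂ) ^ 2 := by
    exact_mod_cast sqrt_one_sub_sq_sq hα0 hα1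
  simp only [dotProduct, Fintype.sum_sum_type, Fin.sum_univ_two, ketAngle, Pi.star_apply,
    Sum.elim_inl, Sum.elim_inr, Matrix.cons_val_zero, Matrix.cons_val_one, RCLike.star_def,
    Complex.conj_ofReal, Pi.zero_apply, mul_zero, Finset.sum_const_zero, add_zero]
  rw [← pow_two, ← pow_two, h]
  ring

theorem conjTranspose_rotationUnitary_mul (d : ℕ) (hα0 : 0 ≤ α) (hα1 : α ≤ 1) :
    (rotationUnitary d α)ᴴ * rotationUnitary d α = 1 := by
  have h : ((√(1 - α ^ 2) : ℝ) : ℂ) ^ 2 = 1 - (α : ℂ) ^ 2 := by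
    exact_mod_cast sqrt_one_sub_sq_sq hα0 hα1
  rw [rotationUnitary, fromBlocks_conjTranspose, fromBlocks_multiply, ← fromBlocks_one]
  congr 1
  · ext i j
    fin_cases i <;> fin_cases j <;>
      simp [Matrix.mul_apply, Fin.sum_univ_two] <;> ring_nf <;> rw [h] <;> ring
  · simp
  · simp
  · simp

theorem rotationUnitary_mulVec_ketZero (d : ℕ) (α : ℝ) :
    rotationUnitary d α *ᵥ ketZero d = ketAngle d α := by
  rw [ketZero_eq_single]
  ext (i | i)
  · fin_cases i <;> simp [rotationUnitary, ketAngle]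
  · simp [rotationUnitary, ketAngle]

/-- The analysis of an admissible plan between the two states in standard position: its cost is
at least the claimed value, and for `α ≠ 0` equality forces the plan of the rotation. -/
theorem standard_plan (hd : 2 ≤ d) (hα0 : 0 ≤ α) (hα1 : α ≤ 1)
    {J : Matrix ((Fin 2 ⊕ Fin (d - 2)) × (Fin 2 ⊕ Fin (d - 2))) _ ℂ}
    (hJ : J ∈ jamiolkowskiMatrices (Fin 2 ⊕ Fin (d - 2)) (Fin 2 ⊕ Fin (d - 2)))
    (hJσ : partialTraceA (extendA _ (ketbra (ketZero d)) * J) = ketbra (ketAngle d α)) :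
    (1 - α) * (d + 2 * α) ≤ planCost (unitaryInvariantCostMatrix _)
      (stateOverTime (ketbra (ketZero d)) J) ∧
    (0 < α → planCost (unitaryInvariantCostMatrix _) (stateOverTime (ketbra (ketZero d)) J) ≤
        (1 - α) * (d + 2 * α) →
      J = jamiolkowski (conjugation (rotationUnitary d α))) := by
  set s : ℝ := √(1 - α ^ 2) with hs
  have hs2 : s ^ 2 = 1 - α ^ 2 := sqrt_one_sub_sq_sq hα0 hα1
  rw [ketZero_eq_single] at hJσ ⊢
  rw [planCost_stateOverTime_ketbra_single _ hJ]
  obtain ⟨hC, htr⟩ := hJ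
  set C := partialTransposeA J with hCdef
  have htr' : ∀ i j, ∑ k, C (i, k) (j, k) = if i = j then 1 else 0 := by
    intro i j
    have := congrFun (congrFun htr j) i
    simp only [partialTraceB, of_apply, Matrix.one_apply] at this
    simp only [hCdef, partialTransposeA, of_apply, this, eq_comm]
  have hz : ∀ k l, C (Sum.inl 0, k) (Sum.inl 0, l) = ketAngle d α k * star (ketAngle d α l) := by
    intro k l
    have := congrFun (congrFun hJσ k) l
    rw [partialTraceA_extendA_ketbra_single_mul] at this
    exact this
  obtain ⟨x, hR, hxz, hcol, horth, hnorm⟩ :=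
    exists_dominant_kraus hC htr' (star_ketAngle_dotProduct_self d hα0 hα1) hz
  have hcost : ∑ a, (C (a, a) (Sum.inl 0, Sum.inl 0)).re = α * ∑ a, (x (a, a)).re := by
    rw [Finset.mul_sum]
    refine Finset.sum_congr rfl fun a _ => ?_
    rw [hcol]
    simp [ketAngle, mul_comm]
  have hx00 : x (Sum.inl 0, Sum.inl 0) = α := by rw [hxz]; simp [ketAngle]
  have hx01 : x (Sum.inl 0, Sum.inl 1) = s := by rw [hxz]; simp [ketAngle, hs]
  -- the row of `|1⟩`
  have h10 : x (Sum.inl 1, Sum.inl 0) * α + x (Sum.inl 1, Sum.inl 1) * s = 0 := by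
    have := horth (Sum.inl 1) (by simp)
    simpa [Fintype.sum_sum_type, Fin.sum_univ_two, ketAngle, ← hs] using this
  have hn1 := hnorm (Sum.inl 1)
  rw [Fintype.sum_sum_type, Fin.sum_univ_two] at hn1
  have hn1' : 0 ≤ ∑ k, ‖x (Sum.inl 1, Sum.inr k)‖ ^ 2 :=
    Finset.sum_nonneg fun k _ => by positivity
  have hsq : s ^ 2 * ‖x (Sum.inl 1, Sum.inl 1)‖ ^ 2 = α ^ 2 * ‖x (Sum.inl 1, Sum.inl 0)‖ ^ 2 := by
    have h := congrArg (fun c => ‖c‖ ^ 2) (eq_neg_of_add_eq_zero_left h10)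
    simp only [norm_neg, norm_mul, mul_pow, Complex.norm_real, Real.norm_eq_abs, sq_abs] at h
    linarith
  -- By orthogonality and the row bound, s²|x₁₁|² = α²|x₁₀|² ≤ α²(1 - |x₁₁|²). With s² + α² = 1 this
  -- is |x₁₁|² ≤ α².
  have hx11n : ‖x (Sum.inl 1, Sum.inl 1)‖ ≤ α := by
    refine abs_le_of_sq_le_sq' ?_ hα0 |>.2
    nlinarith
  have hx11 : (x (Sum.inl 1, Sum.inl 1)).re ≤ α := (Complex.re_le_norm _).trans hx11n
  have hdiagn : ∀ i, ‖x (i, i)‖ ^ 2 ≤ 1 := fun i =>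
    (Finset.single_le_sum (f := fun k => ‖x (i, k)‖ ^ 2) (fun k _ => by positivity)
      (Finset.mem_univ i)).trans (hnorm i)
  have hdiag : ∀ i, (x (i, i)).re ≤ 1 := fun i =>
    (Complex.re_le_norm _).trans (by nlinarith [hdiagn i, norm_nonneg (x (i, i))])
  have hsum : ∑ a, (x (a, a)).re = α + (x (Sum.inl 1, Sum.inl 1)).re +
      ∑ k : Fin (d - 2), (x (Sum.inr k, Sum.inr k)).re := by
    rw [Fintype.sum_sum_type, Fin.sum_univ_two, hx00, Complex.ofReal_re]
  have hsum1 : ∑ k : Fin (d - 2), (1 : ℝ) = d - 2 := by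
    simp [Nat.cast_sub hd]
  have hrest : ∑ k : Fin (d - 2), (x (Sum.inr k, Sum.inr k)).re ≤ d - 2 := by
    rw [← hsum1]
    exact Finset.sum_le_sum fun k _ => hdiag _
  have hcard : (Fintype.card (Fin 2 ⊕ Fin (d - 2)) : ℝ) = d := by
    rw [Fintype.card_sum, Fintype.card_fin, Fintype.card_fin, Nat.add_sub_cancel' hd]
  rw [hcost, hcard, hsum]
  refine ⟨?_, fun hα hmin => ?_⟩
  · nlinarith
  -- Dividing by α is where α > 0 enters: for α = 0 every admissible plan has cost d.
  have hge : α * (2 * α + d - 2) ≤ α * (α + (x (Sum.inl 1, Sum.inl 1)).re +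
      ∑ k : Fin (d - 2), (x (Sum.inr k, Sum.inr k)).re) := by nlinarith
  have hge' := le_of_mul_le_mul_left hge hα
  have hre11 : (x (Sum.inl 1, Sum.inl 1)).re = α := by linarith
  have hrest_eq : ∑ k : Fin (d - 2), (x (Sum.inr k, Sum.inr k)).re =
      ∑ k : Fin (d - 2), (1 : ℝ) := by linarith
  have hre : ∀ k, (x (Sum.inr k, Sum.inr k)).re = 1 := fun k =>
    (Finset.sum_eq_sum_iff_of_le fun k _ => hdiag _).1 hrest_eq k (Finset.mem_univ k)
  -- Attaining a bound on the modulus by the real part forces the entry to be real.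
  have eq_ofReal : ∀ (c : ℂ) (r : ℝ), c.re = r → ‖c‖ ≤ r → c = r := by
    intro c r hc hcn
    have h1 : c.re = ‖c‖ := le_antisymm (Complex.re_le_norm c) (hc ▸ hcn)
    have h2 := Complex.re_eq_norm.1 h1
    exact Complex.ext (by simpa using hc) (by simpa using (Complex.nonneg_iff.1 h2).2.symm)
  have hx11' : x (Sum.inl 1, Sum.inl 1) = α := eq_ofReal _ _ hre11 hx11n
  have hxrr : ∀ k, x (Sum.inr k, Sum.inr k) = 1 := fun k => by
    have := eq_ofReal _ _ (hre k) (by nlinarith [hdiagn (Sum.inr k), norm_nonneg (x (Sum.inr k, Sum.inr k))])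
    simpa using this
  have hαC : (α : ℂ) ≠ 0 := by exact_mod_cast hα.ne'
  have hx10 : x (Sum.inl 1, Sum.inl 0) = -s := by
    rw [hx11'] at h10
    have : (x (Sum.inl 1, Sum.inl 0) + s) * α = 0 := by linear_combination h10
    exact eq_neg_of_add_eq_zero_left ((mul_eq_zero.1 this).resolve_right hαC)
  have hx1r : ∀ k, x (Sum.inl 1, Sum.inr k) = 0 := by
    rw [hx10, hx11'] at hn1
    simp only [norm_neg, Complex.norm_real, Real.norm_eq_abs, sq_abs, hs2] at hn1
    have h0 : ∑ k, ‖x (Sum.inl 1, Sum.inr k)‖ ^ 2 = 0 := by linarith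
    intro k
    have := (Finset.sum_eq_zero_iff_of_nonneg fun k _ => by positivity).1 h0 k (Finset.mem_univ k)
    simpa using this
  -- The diagonal entry 1 exhausts the norm allowed for its row of x.
  have hxr : ∀ k j, j ≠ Sum.inr k → x (Sum.inr k, j) = 0 := by
    intro k j hj
    have h := hnorm (Sum.inr k)
    rw [← Finset.add_sum_erase _ _ (Finset.mem_univ (Sum.inr k)), hxrr] at h
    have h0 : ∑ j ∈ Finset.univ.erase (Sum.inr k), ‖x (Sum.inr k, j)‖ ^ 2 = 0 := by
      refine le_antisymm ?_ (Finset.sum_nonneg fun j _ => by positivity)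
      simpa using h
    have := (Finset.sum_eq_zero_iff_of_nonneg fun j _ => by positivity).1 h0 j (by simp [hj])
    simpa using this
  have hxU : x = fun p => rotationUnitary d α p.2 p.1 := by
    ext ⟨i, k⟩
    rcases i with i | i
    · rcases k with k | k
      · fin_cases i <;> fin_cases k <;>
          simp [rotationUnitary, hx00, hx01, hx10, hx11', ← hs]
      · fin_cases i
        · simp [rotationUnitary, hxz, ketAngle]
        · simp [rotationUnitary, hx1r]
    · rcases k with k | k
      · simp [rotationUnitary, hxr]
      · by_cases hik : k = i
        · subst hik; simp [rotationUnitary, hxrr]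
        · simp [rotationUnitary, hik, hxr]
  have hU := conjTranspose_rotationUnitary_mul d hα0 hα1
  -- Each column of the rotation has norm 1, so each block of the remainder has trace zero, and its
  -- nonnegative diagonal vanishes.
  have hRdiag : ∀ q, (C - vecMulVec x (star x)) q q = 0 := by
    rintro ⟨i, k⟩
    have h0 : ∑ k, (C - vecMulVec x (star x)) (i, k) (i, k) = 0 := by
      have h1 : ∑ k, star (rotationUnitary d α k i) * rotationUnitary d α k i = 1 := by
        have := congrFun (congrFun hU i) i
        simpa [Matrix.mul_apply] using this
      simp only [Matrix.sub_apply, Finset.sum_sub_distrib, htr', if_true, vecMulVec_apply,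
        Pi.star_apply, hxU]
      rw [sub_eq_zero, ← h1]
      exact Finset.sum_congr rfl fun k _ => mul_comm _ _
    exact (Finset.sum_eq_zero_iff_of_nonneg fun k _ => hR.diag_nonneg).1 h0 k (Finset.mem_univ k)
  apply partialTransposeA_injective
  rw [partialTransposeA_jamiolkowski_conjugation, ← hxU]
  exact sub_eq_zero.1 (hR.eq_zero_of_diag_eq_zero hRdiag)

theorem planCost_rotationUnitary (hd : 2 ≤ d) (hα0 : 0 ≤ α) (hα1 : α ≤ 1) :
    planCost (unitaryInvariantCostMatrix _) (stateOverTime (ketbra (ketZero d))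
      (jamiolkowski (conjugation (rotationUnitary d α)))) = (1 - α) * (d + 2 * α) := by
  rw [ketZero_eq_single, planCost_stateOverTime_ketbra_single _
    (jamiolkowski_conjugation_mem (conjTranspose_rotationUnitary_mul d hα0 hα1)),
    partialTransposeA_jamiolkowski_conjugation, Fintype.card_sum, Fintype.card_fin,
    Fintype.card_fin, Nat.add_sub_cancel' hd]
  simp only [vecMulVec_apply, Fintype.sum_sum_type, Fin.sum_univ_two, rotationUnitary,
    Pi.star_apply, fromBlocks_apply₁₁, fromBlocks_apply₂₂]
  simp [Nat.cast_sub hd]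
  ring

theorem conjugation_rotationUnitary_ketbra (d : ℕ) (α : ℝ) :
    conjugation (rotationUnitary d α) (ketbra (ketZero d)) = ketbra (ketAngle d α) := by
  rw [← rotationUnitary_mulVec_ketZero, ketbra_mulVec]
  rfl

theorem stateOverTime_rotationUnitary_mem (hα0 : 0 ≤ α) (hα1 : α ≤ 1) :
    stateOverTime (ketbra (ketZero d)) (jamiolkowski (conjugation (rotationUnitary d α))) ∈
      statesOverTime (ketbra (ketZero d)) (ketbra (ketAngle d α)) :=
  ⟨_, jamiolkowski_conjugation_mem (conjTranspose_rotationUnitary_mul d hα0 hα1), by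
    rw [partialTraceA_extendA_mul_jamiolkowski, conjugation_rotationUnitary_ketbra], rfl⟩

theorem isOptimalChannel_rotationUnitary (hd : 2 ≤ d) (hα0 : 0 ≤ α) (hα1 : α ≤ 1) :
    IsOptimalChannel (unitaryInvariantCostMatrix (Fin 2 ⊕ Fin (d - 2)))
      (ketbra (ketZero d)) (ketbra (ketAngle d α)) (conjugation (rotationUnitary d α)) := by
  refine ⟨jamiolkowski_conjugation_mem (conjTranspose_rotationUnitary_mul d hα0 hα1),
    conjugation_rotationUnitary_ketbra d α, ?_⟩
  rintro Q ⟨J, hJ, hJσ, rfl⟩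
  rw [planCost_rotationUnitary hd hα0 hα1]
  exact (standard_plan hd hα0 hα1 hJ hJσ).1

theorem transportCost_standard (hd : 2 ≤ d) (hα0 : 0 ≤ α) (hα1 : α ≤ 1) :
    transportCost (unitaryInvariantCostMatrix (Fin 2 ⊕ Fin (d - 2)))
      (ketbra (ketZero d)) (ketbra (ketAngle d α)) = (1 - α) * (d + 2 * α) := by
  refine IsLeast.csInf_eq ⟨⟨_, stateOverTime_rotationUnitary_mem hα0 hα1,
    planCost_rotationUnitary hd hα0 hα1⟩, ?_⟩
  rintro _ ⟨Q, ⟨J, hJ, hJσ, rfl⟩, rfl⟩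
  exact (standard_plan hd hα0 hα1 hJ hJσ).1

end StandardCost

/-! ### Uniqueness and transfer to arbitrary pure states -/

theorem eq_of_isOptimalChannel_standard {d : ℕ} {α : ℝ} (hd : 2 ≤ d) (hα0 : 0 < α) (hα1 : α ≤ 1)
    {E : Matrix (Fin 2 ⊕ Fin (d - 2)) (Fin 2 ⊕ Fin (d - 2)) ℂ →ₗ[ℂ]
      Matrix (Fin 2 ⊕ Fin (d - 2)) (Fin 2 ⊕ Fin (d - 2)) ℂ}
    (hE : IsOptimalChannel (unitaryInvariantCostMatrix (Fin 2 ⊕ Fin (d - 2)))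
      (ketbra (ketZero d)) (ketbra (ketAngle d α)) E) :
    E = conjugation (rotationUnitary d α) := by
  obtain ⟨hJ, hEσ, hmin⟩ := hE
  have h := hmin _ (stateOverTime_rotationUnitary_mem hα0.le hα1)
  rw [planCost_rotationUnitary hd hα0.le hα1] at h
  exact jamiolkowski_injective ((standard_plan hd hα0.le hα1 hJ
    (by rw [partialTraceA_extendA_mul_jamiolkowski, hEσ])).2 hα0 h)

open scoped Kronecker in
theorem IsOptimalChannel.conjugation_conj {n : Type*} [Fintype n] [DecidableEq n]
    {V U ρ σ : Matrix n n ℂ} (hV : V * Vᴴ = 1)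
    (h : IsOptimalChannel (unitaryInvariantCostMatrix n) (V * ρ * Vᴴ) (V * σ * Vᴴ)
      (conjugation U)) :
    IsOptimalChannel (unitaryInvariantCostMatrix n) ρ σ (conjugation (Vᴴ * U * V)) := by
  obtain ⟨hJ, hσ, hmin⟩ := h
  have hV' : Vᴴ * Vᴴᴴ = 1 := by
    rw [conjTranspose_conjTranspose]; exact mul_eq_one_comm.1 hV
  have hjam : jamiolkowski (conjugation (Vᴴ * U * V)) =
      (Vᴴ ⊗ₖ Vᴴ) * jamiolkowski (conjugation U) * (Vᴴ ⊗ₖ Vᴴ)ᴴ := by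
    have := jamiolkowski_conjugation_conj (V := Vᴴ) U
    rwa [conjTranspose_conjTranspose] at this
  refine ⟨?_, ?_, fun Q hQ => ?_⟩
  · rw [hjam]
    exact kronecker_conj_mem_jamiolkowskiMatrices hV' hJ
  · calc conjugation (Vᴴ * U * V) ρ = Vᴴ * conjugation U (V * ρ * Vᴴ) * Vᴴᴴ := by
          simp [conjugation, Matrix.mul_assoc]
      _ = σ := by rw [hσ, conjTranspose_conj_conj hV]
  · have h1 := stateOverTime_conj hV' (V * ρ * Vᴴ) (jamiolkowski (conjugation U))
    rw [conjTranspose_conj_conj hV] at h1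
    -- Both sides are carried to the conjugated problem, where the optimality of U applies.
    rw [hjam, h1, planCost_kronecker_conj hV', ← planCost_kronecker_conj hV Q]
    exact hmin _ (kronecker_conj_mem_statesOverTime hV hQ)

theorem mainTheorem4 (d : ℕ) (hd : 2 ≤ d) :
    -- the two states in the standard position
    (∀ α : ℝ, 0 ≤ α → α ≤ 1 →
      transportCost (unitaryInvariantCostMatrix (Fin 2 ⊕ Fin (d - 2)))
          (ketbra (ketZero d)) (ketbra (ketAngle d α)) = (1 - α) * (d + 2 * α) ∧
      IsOptimalChannel (unitaryInvariantCostMatrix (Fin 2 ⊕ Fin (d - 2)))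
          (ketbra (ketZero d)) (ketbra (ketAngle d α)) (conjugation (rotationUnitary d α)) ∧
      (0 < α → ∀ E : Matrix (Fin 2 ⊕ Fin (d - 2)) (Fin 2 ⊕ Fin (d - 2)) ℂ →ₗ[ℂ]
            Matrix (Fin 2 ⊕ Fin (d - 2)) (Fin 2 ⊕ Fin (d - 2)) ℂ,
          IsOptimalChannel (unitaryInvariantCostMatrix (Fin 2 ⊕ Fin (d - 2)))
            (ketbra (ketZero d)) (ketbra (ketAngle d α)) E →
          E = conjugation (rotationUnitary d α))) ∧
    -- two arbitrary pure states, with their reduction to the standard position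
    (∀ ψ φ : Fin 2 ⊕ Fin (d - 2) → ℂ, star ψ ⬝ᵥ ψ = 1 → star φ ⬝ᵥ φ = 1 →
      ∀ α : ℝ, α = ‖star ψ ⬝ᵥ φ‖ →
      transportCost (unitaryInvariantCostMatrix (Fin 2 ⊕ Fin (d - 2)))
          (ketbra ψ) (ketbra φ) = (1 - α) * (d + 2 * α) ∧
      ∃ V ∈ Matrix.unitaryGroup (Fin 2 ⊕ Fin (d - 2)) ℂ,
        V * ketbra ψ * Vᴴ = ketbra (ketZero d) ∧
        V * ketbra φ * Vᴴ = ketbra (ketAngle d α) ∧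
        IsOptimalChannel (unitaryInvariantCostMatrix (Fin 2 ⊕ Fin (d - 2)))
          (ketbra ψ) (ketbra φ) (conjugation (Vᴴ * rotationUnitary d α * V))) := by

  refine ⟨fun α hα0 hα1 => ⟨transportCost_standard hd hα0 hα1,
    isOptimalChannel_rotationUnitary hd hα0 hα1,
    fun hα E hE => eq_of_isOptimalChannel_standard hd hα hα1 hE⟩, ?_⟩
  rintro ψ φ hψ hφ α rfl
  obtain ⟨V, hV, h0, h1⟩ := exists_unitary_conj_ketbra_eq d hψ hφ
  have hle := norm_star_dotProduct_le_one hψ hφ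
  refine ⟨?_, V, mem_unitaryGroup_iff.2 hV, h0, h1, ?_⟩
  · rw [← transportCost_conj hV, h0, h1, transportCost_standard hd (norm_nonneg _) hle]
  · refine IsOptimalChannel.conjugation_conj hV ?_
    rw [h0, h1]
    exact isOptimalChannel_rotationUnitary hd (norm_nonneg _) hle
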